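/- **The model (Strategy 1).** Let $0\le q<p$ with $p+q=1$, let $\gamma\in[0,1]$ and let $n_1\ge 1$ be an integer. Blocks are mined one after the other; independently for each block, its miner is the attacker with probability $q$ and an honest miner with probability $p$. An attack cycle starts when all miners agree on a single chain and ends as soon as this is again the case. During a cycle the attacker mines only on his own fork and keeps it secret, except that: - when an honest block is mined and the honest branch thereby becomes higher than the fork, the attacker gives up his fork (the cycle ends); - when an honest block is mined and the fork is then ahead of the honest branch by exactly one block, he publishes the whole fork, which wins (the cycle ends); - when any other honest block is mined, he publishes the part of his fork up to the height of that block; - when he mines a block while his completely published fork competes with an honest branch of the same height, he publishes this block and his fork wins (the cycle ends). Whenever the published part of the fork and an honest branch of the same height compete, the next honest block, if it is mined before the competition ends, is mined on the attacker's branch with probability $\gamma$ and on the honest branch with probability $1-\gamma$, independently of everything else. The official blockchain consists of the blocks that finally stay in the chain common to all miners. An *uncle* is an orphan block (one that is not official) whose parent is official. All miners refer to all possible uncles, without a limit on the number of references per block: the *nephew* of an uncle $\mathfrak b$ is the first official block mined after $\mathfrak b$ (in the same cycle or later) that descends from the parent of $\mathfrak b$ and whose distance $d$ to $\mathfrak b$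 satisfies $1\le d\le n_1$, where $d$ is the number of official blocks strictly between that block and the parent of $\mathfrak b$. The uncle is *referred* if such a block exists, and $\delta(\mathfrak b)$ denotes the distance $d$ between $\mathfrak b$ and its nephew. For an attack cycle $\omega$, let $\Delta(\omega)=\sum_{\mathfrak b}\delta(\mathfrak b)$, the sum over all referred uncles $\mathfrak b$ that are mined during $\omega$. **Proposition.** The random variable $\Delta$ is integrable and $$\mathbb E[\Delta]=pq+\frac{pq^2\gamma}{(p-q)^2}\left(2p-q-\bigl(p+n_1(p-q)\bigr)\left(\frac qp\right)^{n_1-1}\right)+\frac{(1-\gamma)q}{p}\Bigl(q(1+p)-(1+n_1p)\,q^{n_1}\Bigr).$$ -/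

import Mathlib

open MeasureTheory ProbabilityTheory

namespace SelfishMining

/-- A chain of blocks, newest block first. Exactly one block is mined in each round, and the block
mined in round `n` is called `n`. The genesis block, common to all chains, is not listed (the empty
list is the chain that consists of the genesis block alone), so the length of the list is the
height of its newest block. -/
abbrev Chain := List ℕ

/-- What the miners work on between two rounds: `fork` is the chain of the attacker (its newest
blocks may still be secret), `honest` the public chain of maximal height that does not come from
the current fork. The two are equal exactly when an attack cycle is over and a new one begins. -/
structure State where
  fork : Chain
  honest : Chain

/-- The public part of the attacker's fork: at any time he has released exactly the blocks whose
height is at most that of the honest chain. -/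
def State.published (s : State) : Chain :=
  s.fork.drop (s.fork.length - s.honest.length)

/-- The chain on top of which the next block is mined. The attacker extends his fork. An honest
miner extends either the published part of the fork (if `onFork`) or the honest chain: these have
the same height (and are the same chain if nothing has been published in the current cycle). -/
def State.base (s : State) (selfish onFork : Bool) : Chain :=
  if selfish then s.fork else if onFork then s.published else s.honest

/-- Round `n` under Strategy 1, with the attacker's reaction.

* If the attacker mines the block, he keeps it secret, unless his fork was in an open competition
  with an honest branch of the same height and had no secret block left: then he publishes his
  block and wins.
* If an honest miner mines the block, then: if the new public chain is higher than the fork, the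
  attacker gives up his fork; if the fork is ahead by exactly one block, he publishes it entirely
  and wins; otherwise he publishes his fork up to the height of the new block. -/
def State.step (s : State) (n : ℕ) (selfish onFork : Bool) : State :=
  let c : Chain := n :: s.base selfish onFork
  if selfish then
    if s.fork ≠ s.honest ∧ s.fork.length = s.honest.length then ⟨c, c⟩ else ⟨c, s.honest⟩
  else
    if s.fork.length < c.length then ⟨c, c⟩
    else if s.fork.length = c.length + 1 then ⟨s.fork, s.fork⟩
    else ⟨s.fork, c⟩

/-- The state before round `n`. `x n` says whether the attacker mines the block of round `n`;
`g n` whether the miner of that block, if honest, prefers the attacker's branch. -/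
def state (x g : ℕ → Bool) : ℕ → State
  | 0 => ⟨[], []⟩
  | n + 1 => (state x g n).step n (x n) (g n)

/-- The chain that ends with the parent of block `n`. -/
def base (x g : ℕ → Bool) (n : ℕ) : Chain :=
  (state x g n).base (x n) (g n)

/-- Block `b` belongs to the official blockchain: it stays forever in the public chain from some
time on. -/
def Official (x g : ℕ → Bool) (b : ℕ) : Prop :=
  ∀ᶠ t in Filter.atTop, b ∈ (state x g t).honest

/-- An uncle is an orphan block whose parent (the genesis block, or a block `a`) belongs to the
official blockchain. -/
def Uncle (x g : ℕ → Bool) (b : ℕ) : Prop :=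
  ¬ Official x g b ∧ ∀ a ∈ (base x g b).head?, Official x g a

/-- The distance between an uncle `b` and a nephew `N`: the number of blocks strictly between `N`
and the parent of `b`, when that parent is an ancestor of `N`. -/
def distance (x g : ℕ → Bool) (b N : ℕ) : ℕ :=
  (base x g N).length - (base x g b).length

/-- `N` is an official block, mined after `b`, that descends from the parent of `b` and is at a
distance between `1` and `n₁` of `b`, so that it may refer to `b`. -/
def CanRefer (x g : ℕ → Bool) (n₁ b N : ℕ) : Prop :=
  Official x g N ∧ b < N ∧ base x g b <:+ base x g N ∧
    1 ≤ distance x g b N ∧ distance x g b N ≤ n₁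

/-- `b` is an uncle which is referred by a nephew: all miners signal all possible uncles. -/
def Referred (x g : ℕ → Bool) (n₁ b : ℕ) : Prop :=
  Uncle x g b ∧ ∃ N, CanRefer x g n₁ b N

/-- The nephew of a referred uncle: the first official block that may refer to it. -/
noncomputable def nephew (x g : ℕ → Bool) (n₁ b : ℕ) : ℕ :=
  sInf {N | CanRefer x g n₁ b N}

/-- The number of blocks mined during the (first) attack cycle, which ends as soon as all miners
agree again on a single chain (by convention `0` if this never happens). -/
noncomputable def cycleLength (x g : ℕ → Bool) : ℕ :=
  sInf {t | 0 < t ∧ (state x g t).fork = (state x g t).honest}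

open Classical in
/-- The sum of the uncle-nephew distances over the uncles created during the attack cycle that
are referred, in this cycle or later. -/
noncomputable def totalDistance (n₁ : ℕ) (x g : ℕ → Bool) : ℕ :=
  ∑ b ∈ Finset.range (cycleLength x g),
    if Referred x g n₁ b then distance x g b (nephew x g n₁ b) else 0

end SelfishMining

namespace SelfishMining

/-! The proof splits into a pathwise identity and a potential argument. Whenever the miners agree
again, the fate of all earlier blocks is settled (`official_iff`). If the attacker mines the first
two blocks of the cycle, his whole fork wins, so the uncles are exactly the honest blocks whose
parent lies on the fork or is the genesis block; the next official block above the fork as it stood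
then is the only nephew to test, and its distance is the attacker's lead before the uncle was mined
(`uncle_contribution`). Hence the total distance is a sum of rewards, each depending only on the
current `Phase` and on the two bits of the round (`totalDistance_eq_sum_reward`). The phases form a
Markov chain, and `potential` is chosen so that the mean reward of a round is the mean drop of the
potential (`bitMean_potential`). The expected rewards of the first `N` rounds therefore telescope to
the initial potential minus the expected potential at `N`. Since `q < 1/2`, the cycle ends almost
surely (`ae_tendsto_walk`, `exists_agree_of_tendsto`); the potential is bounded and vanishes in the
phase `done`, so the remainder tends to zero. Monotone convergence yields integrability and the
mean, and `potential_init` is its closed form. -/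

/-- All miners agree on a single chain before round `t`. -/
def Agree (x g : ℕ → Bool) (t : ℕ) : Prop :=
  (state x g t).fork = (state x g t).honest

/-! ### Invariants of chains and official blocks -/

theorem State.step_induction {P : Chain → Prop} {s : State} {n : ℕ} {u v : Bool}
    (hf : P s.fork) (hh : P s.honest) (hc : P (n :: s.base u v)) :
    P (s.step n u v).fork ∧ P (s.step n u v).honest := by
  unfold State.step
  dsimp only
  split_ifs <;> simp_all

theorem State.published_suffix (s : State) : s.published <:+ s.fork :=
  List.drop_suffix _ _

theorem State.base_suffix (s : State) (u v : Bool) :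
    s.base u v <:+ s.fork ∨ s.base u v <:+ s.honest := by
  unfold State.base
  split_ifs
  · exact Or.inl (List.suffix_refl _)
  · exact Or.inl s.published_suffix
  · exact Or.inr (List.suffix_refl _)

theorem State.length_published {s : State} (h : s.honest.length ≤ s.fork.length) :
    s.published.length = s.honest.length := by
  rw [State.published, List.length_drop]
  omega

theorem State.length_base {s : State} (h : s.honest.length ≤ s.fork.length) (u v : Bool) :
    (s.base u v).length = if u then s.fork.length else s.honest.length := by
  unfold State.base
  split_ifs
  · rfl
  · exact State.length_published h
  · rfl

variable {x g : ℕ → Bool}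

theorem state_succ (n : ℕ) : state x g (n + 1) = (state x g n).step n (x n) (g n) := rfl

theorem length_honest_le (n : ℕ) :
    (state x g n).honest.length ≤ (state x g n).fork.length := by
  induction n with
  | zero => simp [state]
  | succ n ih =>
    have hb := State.length_base ih (x n) (g n)
    rw [state_succ, State.step]
    split_ifs with h1 h2 h3 h4 <;> simp_all
    omega

/-- An invariant of chains which passes to suffixes and is inherited by each new chain holds for
both chains of every later state. -/
theorem state_induction {P : ℕ → Chain → Prop} {t₀ : ℕ}
    (hf : P t₀ (state x g t₀).fork) (hh : P t₀ (state x g t₀).honest)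
    (hmono : ∀ t c, P t c → P (t + 1) c)
    (hstep : ∀ t, t₀ ≤ t → P t (state x g t).fork → P t (state x g t).honest →
      P (t + 1) (t :: base x g t)) {t : ℕ} (ht : t₀ ≤ t) :
    P t (state x g t).fork ∧ P t (state x g t).honest := by
  induction t, ht using Nat.le_induction with
  | base => exact ⟨hf, hh⟩
  | succ t ht ih =>
    rw [state_succ]
    exact State.step_induction (hmono t _ ih.1) (hmono t _ ih.2) (hstep t ht ih.1 ih.2)

theorem lt_of_mem (t : ℕ) :
    (∀ a ∈ (state x g t).fork, a < t) ∧ ∀ a ∈ (state x g t).honest, a < t := by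
  refine state_induction (P := fun t c => ∀ a ∈ c, a < t) (t₀ := 0) ?_ ?_ ?_ ?_ (Nat.zero_le t)
  · simp [state]
  · simp [state]
  · intro t c h a ha
    exact (h a ha).trans (Nat.lt_succ_self t)
  · intro t _ h1 h2 a ha
    rcases List.mem_cons.1 ha with rfl | ha
    · exact Nat.lt_succ_self _
    · rcases (state x g t).base_suffix (x t) (g t) with h | h
      · exact (h1 a (h.subset ha)).trans (Nat.lt_succ_self t)
      · exact (h2 a (h.subset ha)).trans (Nat.lt_succ_self t)

theorem lt_of_mem_base {a t : ℕ} (ha : a ∈ base x g t) : a < t := by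
  rcases (state x g t).base_suffix (x t) (g t) with h | h
  · exact (lt_of_mem t).1 a (h.subset ha)
  · exact (lt_of_mem t).2 a (h.subset ha)

/-- Blocks are only ever placed on top of their `base`, so a block determines the chain below it,
whichever chain contains it. -/
theorem base_eq_of_suffix (t : ℕ) :
    (∀ a l, (a :: l) <:+ (state x g t).fork → base x g a = l) ∧
      ∀ a l, (a :: l) <:+ (state x g t).honest → base x g a = l := by
  refine state_induction (P := fun _ c => ∀ a l, (a :: l) <:+ c → base x g a = l) (t₀ := 0)
    ?_ ?_ ?_ ?_ (Nat.zero_le t)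
  · simp [state]
  · simp [state]
  · exact fun t c h => h
  · intro t _ h1 h2 a l hal
    rcases List.suffix_cons_iff.1 hal with h | h
    · obtain ⟨rfl, rfl⟩ := List.cons.inj h
      rfl
    · rcases (state x g t).base_suffix (x t) (g t) with h' | h'
      · exact h1 a l (h.trans h')
      · exact h2 a l (h.trans h')

theorem cons_base_suffix {a t : ℕ} (ha : a ∈ (state x g t).fork) :
    (a :: base x g a) <:+ (state x g t).fork := by
  obtain ⟨l₁, l₂, h⟩ := List.append_of_mem ha
  have h' : (a :: l₂) <:+ (state x g t).fork := ⟨l₁, h.symm⟩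
  rwa [(base_eq_of_suffix t).1 a l₂ h']

theorem mem_of_agree {t₀ t : ℕ} (h₀ : Agree x g t₀) (ht : t₀ ≤ t) :
    (∀ a ∈ (state x g t).fork, a ∈ (state x g t₀).fork ∨ t₀ ≤ a) ∧
      ∀ a ∈ (state x g t).honest, a ∈ (state x g t₀).fork ∨ t₀ ≤ a := by
  refine state_induction (P := fun _ c => ∀ a ∈ c, a ∈ (state x g t₀).fork ∨ t₀ ≤ a)
    ?_ ?_ ?_ ?_ ht
  · exact fun a ha => Or.inl ha
  · exact fun a ha => Or.inl (h₀ ▸ ha)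
  · exact fun t c h => h
  · intro t ht h1 h2 a ha
    rcases List.mem_cons.1 ha with rfl | ha
    · exact Or.inr ht
    · rcases (state x g t).base_suffix (x t) (g t) with h | h
      · exact h1 a (h.subset ha)
      · exact h2 a (h.subset ha)

theorem suffix_of_agree {t₀ t : ℕ} (h₀ : Agree x g t₀) (ht : t₀ ≤ t) :
    (state x g t₀).fork <:+ (state x g t).fork ∧ (state x g t₀).fork <:+ (state x g t).honest := by
  refine state_induction (P := fun _ c => (state x g t₀).fork <:+ c) ?_ ?_ ?_ ?_ ht
  · exact List.suffix_refl _
  · exact h₀ ▸ List.suffix_refl _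
  · exact fun t c h => h
  · intro t _ h1 h2
    refine List.IsSuffix.trans ?_ (List.suffix_cons _ _)
    have hlen := State.length_base (length_honest_le t (x := x) (g := g)) (x t) (g t)
    -- Two suffixes of one list are ordered by their lengths, so a comparison of heights is enough.
    have hle : (state x g t₀).fork.length ≤ (base x g t).length := by
      rw [base, hlen]
      split_ifs
      · exact h1.length_le
      · exact h2.length_le
    rcases (state x g t).base_suffix (x t) (g t) with h | h
    · exact List.suffix_of_suffix_length_le h1 h hle
    · exact List.suffix_of_suffix_length_le h2 h hle

/-- Blocks that join a chain from round `t` on are numbered at least `t`, and the chain agreed upon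
remains below all later ones. -/
theorem official_iff {b t : ℕ} (ht : Agree x g t)
    (hb : b < t) : Official x g b ↔ b ∈ (state x g t).fork := by
  constructor
  · intro h
    obtain ⟨s, hs⟩ := Filter.eventually_atTop.1 h
    rcases (mem_of_agree ht (le_max_right s t)).2 b (hs _ (le_max_left s t)) with h | h
    · exact h
    · omega
  · intro h
    exact Filter.eventually_atTop.2 ⟨t, fun s hs => (suffix_of_agree ht hs).2.subset h⟩

/-! ### Growth of the common chain and the nephew of an uncle -/

theorem length_fork_le_succ (t : ℕ) :
    (state x g t).fork.length ≤ (state x g (t + 1)).fork.length := by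
  rw [state_succ, State.step]
  split_ifs with h1 h2 h3 h4
  · simp [State.base, h1]
  · simp [State.base, h1]
  · exact h3.le
  · exact le_rfl
  · exact le_rfl

theorem length_fork_mono : Monotone fun t => (state x g t).fork.length :=
  monotone_nat_of_le_succ length_fork_le_succ

theorem length_fork_succ_of_agree {t : ℕ} (ht : Agree x g t) :
    (state x g t).fork.length < (state x g (t + 1)).fork.length := by
  have hlen := State.length_base (length_honest_le t (x := x) (g := g)) (x t) (g t)
  have h' : (state x g t).fork.length = (state x g t).honest.length := congrArg List.length ht
  rw [state_succ, State.step]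
  split_ifs with h1 h2 h3 h4 <;> simp_all

theorem exists_agree_length (hrec : ∀ t, ∃ t' ≥ t, Agree x g t') (m t : ℕ) :
    ∃ t' ≥ t, Agree x g t' ∧ m ≤ (state x g t').fork.length := by
  induction m with
  | zero =>
    obtain ⟨t', h, h'⟩ := hrec t
    exact ⟨t', h, h', Nat.zero_le _⟩
  | succ m ih =>
    obtain ⟨s, hs, hs', hm⟩ := ih
    obtain ⟨t', h, h'⟩ := hrec (s + 1)
    refine ⟨t', by omega, h', ?_⟩
    have h1 := length_fork_succ_of_agree hs'
    have h2 := length_fork_mono (x := x) (g := g) h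
    dsimp only at h2
    omega

-- `F` is the part of the final chain that is useless for referring to `b`: by `h1` its blocks are
-- too old or at distance 0, while by `h2` all blocks above it are younger than `b`. The first
-- official block above `F` is then the earliest and nearest candidate; if it is too far away, so
-- are all others.
open Classical in
theorem uncle_contribution (hrec : ∀ t, ∃ t' ≥ t, Agree x g t') {n₁ b T : ℕ} {F : Chain}
    (hb : Uncle x g b) (hT : Agree x g T) (hbT : b < T) (hF : F <:+ (state x g T).fork)
    (hbF : base x g b <:+ F) (hlt : (base x g b).length < F.length)
    (h1 : ∀ N ∈ F, b < N → distance x g b N = 0)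
    (h2 : ∀ N ∈ (state x g T).fork, N ∉ F → b < N) :
    (if Referred x g n₁ b then distance x g b (nephew x g n₁ b) else 0) =
      if F.length - (base x g b).length ≤ n₁ then F.length - (base x g b).length else 0 := by
  -- At time `T` there may be no block above `F` yet: the nephew may belong to a later cycle.
  obtain ⟨T', hTT', hT', hlen⟩ := exists_agree_length hrec (F.length + 1) T
  have hFT' : F <:+ (state x g T').fork := hF.trans (suffix_of_agree hT hTT').1
  obtain ⟨N₀, hN₀⟩ : ∃ N₀, (N₀ :: F) <:+ (state x g T').fork := by
    obtain ⟨l, hl⟩ := hFT'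
    rcases List.eq_nil_or_concat l with rfl | ⟨l', a, rfl⟩
    · rw [← hl] at hlen
      simp at hlen
    · exact ⟨a, l', by simpa using hl⟩
  have hbase : base x g N₀ = F := (base_eq_of_suffix T').1 N₀ F hN₀
  have hmem : N₀ ∈ (state x g T').fork := hN₀.subset List.mem_cons_self
  have hN₀F : N₀ ∉ F := fun h => (lt_irrefl _) (lt_of_mem_base (hbase ▸ h : N₀ ∈ base x g N₀))
  have hbN₀ : b < N₀ := by
    rcases (mem_of_agree hT hTT').1 N₀ hmem with h | h
    · exact h2 N₀ h hN₀F
    · omega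
  have hoff : Official x g N₀ := (official_iff hT' ((lt_of_mem T').1 _ hmem)).2 hmem
  have hdist : distance x g b N₀ = F.length - (base x g b).length := by
    rw [distance, hbase]
  have key : ∀ N, CanRefer x g n₁ b N → N₀ ≤ N ∧ distance x g b N₀ ≤ distance x g b N := by
    rintro N ⟨hN, hbN, -, hd, -⟩
    have hNF : N ∉ F := fun h => by
      have := h1 N h hbN
      omega
    obtain ⟨S, hS, hSA⟩ := hrec (max T' (N + 1))
    have hNS : N < S := by omega
    have hNm := (official_iff hSA hNS).1 hN
    have hs1 := cons_base_suffix hNm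
    have hs2 : (N₀ :: F) <:+ (state x g S).fork :=
      hN₀.trans (suffix_of_agree hT' (by omega)).1
    -- Both are suffixes of one chain, hence comparable; the wrong order would put `N` in `F`.
    have hs : (N₀ :: F) <:+ (N :: base x g N) := by
      rcases List.suffix_or_suffix_of_suffix hs1 hs2 with h | h
      · rcases List.suffix_cons_iff.1 h with h | h
        · rw [h]
        · exact absurd (h.subset List.mem_cons_self) hNF
      · exact h
    constructor
    · rcases List.mem_cons.1 (hs.subset List.mem_cons_self) with h | h
      · exact h.le
      · exact (lt_of_mem_base h).le
    · have := hs.length_le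
      rw [hdist, distance]
      simp only [List.length_cons] at this
      omega
  by_cases hd : F.length - (base x g b).length ≤ n₁
  · have hcan : CanRefer x g n₁ b N₀ := ⟨hoff, hbN₀, hbase ▸ hbF, by omega, by omega⟩
    have hneph : nephew x g n₁ b = N₀ :=
      le_antisymm (Nat.sInf_le hcan) (key _ (Nat.sInf_mem (s := {N | CanRefer x g n₁ b N}) ⟨N₀, hcan⟩)).1
    rw [if_pos ⟨hb, N₀, hcan⟩, if_pos hd, hneph, hdist]
  · rw [if_neg hd, if_neg]
    rintro ⟨-, N, hN⟩
    have h3 := (key N hN).2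
    have h4 := hN.2.2.2.2
    omega

/-! ### The first cycle as a sequence of phases with rewards -/

/-- The progress of the first attack cycle. In the phase `ahead k fresh` the attacker, who has
mined the first two blocks, leads by `k + 2` blocks; `fresh` says that no honest block has been
mined yet. -/
inductive Phase where
  | init : Phase
  | one : Phase
  | tie : Phase
  | ahead : ℕ → Bool → Phase
  | done : Phase

/-- The next phase, if the attacker mines the next block or not. -/
def Phase.next : Phase → Bool → Phase
  | .init, true => .one
  | .init, false => .done
  | .one, true => .ahead 0 true
  | .one, false => .tie
  | .tie, _ => .done
  | .ahead k fresh, true => .ahead (k + 1) fresh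
  | .ahead 0 _, false => .done
  | .ahead (k + 1) _, false => .ahead k false
  | .done, _ => .done

/-- The contribution of an uncle at distance `d` of the next official block. -/
def cutoff (n₁ d : ℕ) : ℕ := if d ≤ n₁ then d else 0

/-- The uncle-nephew distance that is attributed to a round. -/
def Phase.reward (n₁ : ℕ) : Phase → Bool → Bool → ℕ
  | .tie, _, _ => 1
  | .ahead k fresh, false, onFork => if fresh || onFork then cutoff n₁ (k + 2) else 0
  | _, _, _ => 0

/-- The phase before round `n`. -/
def phase (x : ℕ → Bool) : ℕ → Phase
  | 0 => .init
  | n + 1 => (phase x n).next (x n)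

theorem phase_congr {x y : ℕ → Bool} {n : ℕ} (h : ∀ i < n, x i = y i) : phase x n = phase y n := by
  induction n with
  | zero => rfl
  | succ n ih => rw [phase, phase, ih fun i hi => h i (by omega), h n (by omega)]

theorem phase_done {T N : ℕ} (h : phase x T = .done) (hN : T ≤ N) : phase x N = .done := by
  induction N, hN using Nat.le_induction with
  | base => exact h
  | succ N _ ih => rw [phase, ih, Phase.next]

theorem sum_reward_of_done {n₁ T N : ℕ} (h : phase x T = .done) (hN : T ≤ N) :
    ∑ b ∈ Finset.range N, (phase x b).reward n₁ (x b) (g b) =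
      ∑ b ∈ Finset.range T, (phase x b).reward n₁ (x b) (g b) := by
  symm
  refine Finset.sum_subset (by simpa using hN) fun b _ hb => ?_
  rw [phase_done h (by simpa using hb)]
  rfl

theorem cycleLength_spec (hrec : ∀ t, ∃ t' ≥ t, Agree x g t') :
    0 < cycleLength x g ∧ Agree x g (cycleLength x g) := by
  obtain ⟨t, ht, ht'⟩ := hrec 1
  exact Nat.sInf_mem (s := {t | 0 < t ∧ (state x g t).fork = (state x g t).honest}) ⟨t, ht, ht'⟩

theorem not_agree_of_lt {t : ℕ} (h0 : 0 < t) (ht : t < cycleLength x g) : ¬ Agree x g t :=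
  fun h => Nat.notMem_of_lt_sInf ht ⟨h0, h⟩

/-- The state during a cycle in which the attacker mined the first two blocks. -/
structure AheadAt (x g : ℕ → Bool) (t k : ℕ) (fresh : Bool) : Prop where
  phase_eq : phase x t = .ahead k fresh
  length_eq : (state x g t).fork.length = (state x g t).honest.length + k + 2
  fork_selfish : ∀ a ∈ (state x g t).fork, x a = true
  head_honest : ∀ a ∈ (state x g t).honest.head?, x a = false
  fresh_iff : fresh = true ↔ (state x g t).honest = []

theorem AheadAt.state_selfish {t k : ℕ} {fresh : Bool} (h : AheadAt x g t k fresh)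
    (hx : x t = true) :
    state x g (t + 1) = ⟨t :: (state x g t).fork, (state x g t).honest⟩ := by
  have := h.length_eq
  rw [state_succ, State.step, if_pos hx, if_neg (by omega), hx]
  rfl

theorem length_base_of_honest {t : ℕ} (hx : x t = false) : (base x g t).length = (state x g t).honest.length := by
  rw [base, State.length_base (length_honest_le t), hx]
  rfl

theorem AheadAt.state_honest {t k : ℕ} {fresh : Bool} (h : AheadAt x g t k fresh)
    (hx : x t = false) :
    state x g (t + 1) = if k = 0 then ⟨(state x g t).fork, (state x g t).fork⟩ else
      ⟨(state x g t).fork, t :: base x g t⟩ := by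
  have h1 := h.length_eq
  have h2 := length_base_of_honest (g := g) hx
  rw [base] at h2
  rw [state_succ, State.step, if_neg (by simp [hx]), List.length_cons, h2, if_neg (by omega)]
  by_cases hk : k = 0
  · rw [if_pos (by omega), if_pos hk]
  · rw [if_neg (by omega), if_neg hk]
    rfl

theorem AheadAt.succ {t k : ℕ} {fresh : Bool} (h : AheadAt x g t k fresh)
    (hne : ¬ Agree x g (t + 1)) : ∃ k' fresh', AheadAt x g (t + 1) k' fresh' := by
  cases hx : x t with
  | true =>
    have hs := h.state_selfish hx
    refine ⟨k + 1, fresh, ?_, ?_, ?_, ?_, ?_⟩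
    · rw [phase, h.phase_eq, hx, Phase.next]
    · rw [hs]
      simp only [List.length_cons, h.length_eq]
      omega
    · rw [hs]
      intro a ha
      rcases List.mem_cons.1 ha with rfl | ha
      · exact hx
      · exact h.fork_selfish a ha
    · rw [hs]
      exact h.head_honest
    · rw [hs]
      exact h.fresh_iff
  | false =>
    have hs := h.state_honest hx
    rcases k with _ | k
    · exact absurd (by rw [Agree, hs, if_pos rfl]) hne
    · rw [if_neg (by omega)] at hs
      refine ⟨k, false, ?_, ?_, ?_, ?_, ?_⟩
      · rw [phase, h.phase_eq, hx, Phase.next]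
      · rw [hs]
        simp only [List.length_cons, h.length_eq, length_base_of_honest hx]
        omega
      · rw [hs]
        exact h.fork_selfish
      · rw [hs]
        simpa using hx
      · rw [hs]
        simp

theorem AheadAt.fork_succ {t k : ℕ} {fresh : Bool} (h : AheadAt x g t k fresh) :
    (state x g (t + 1)).fork = if x t = true then t :: (state x g t).fork
      else (state x g t).fork := by
  cases hx : x t with
  | true => rw [h.state_selfish hx]; rfl
  | false =>
    rw [h.state_honest hx]
    split_ifs <;> first | rfl | simp_all

theorem AheadAt.of_agree_succ {t k : ℕ} {fresh : Bool} (h : AheadAt x g t k fresh)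
    (ha : Agree x g (t + 1)) : x t = false ∧ k = 0 := by
  cases hx : x t with
  | true =>
    rw [Agree, h.state_selfish hx] at ha
    have h1 := congrArg List.length ha
    have h2 := h.length_eq
    simp only [List.length_cons] at h1
    omega
  | false =>
    refine ⟨rfl, ?_⟩
    by_contra hk
    rw [Agree, h.state_honest hx, if_neg hk] at ha
    have h1 := congrArg List.length ha
    have h2 := h.length_eq
    simp only [List.length_cons, length_base_of_honest hx] at h1
    omega

theorem state_one (hx : x 0 = true) : state x g 1 = ⟨[0], []⟩ := by
  simp [state, State.step, State.base, hx]

theorem state_one_of_honest (hx : x 0 = false) : state x g 1 = ⟨[0], [0]⟩ := by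
  simp [state, State.step, State.base, hx, State.published]

theorem state_two (h0 : x 0 = true) (h1 : x 1 = true) : state x g 2 = ⟨[1, 0], []⟩ := by
  rw [state_succ, state_one h0]
  simp [State.step, State.base, h1]

theorem state_two_of_honest (h0 : x 0 = true) (h1 : x 1 = false) :
    state x g 2 = ⟨[0], [1]⟩ := by
  rw [state_succ, state_one h0]
  simp [State.step, State.base, h1, State.published]

theorem state_three (h0 : x 0 = true) (h1 : x 1 = false) :
    state x g 3 = if x 2 = true ∨ g 2 = true then ⟨[2, 0], [2, 0]⟩ else ⟨[2, 1], [2, 1]⟩ := by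
  rw [state_succ, state_two_of_honest h0 h1]
  cases h2 : x 2 <;> cases h3 : g 2 <;> simp [State.step, State.base, State.published]

theorem cycleLength_eq {t : ℕ} (h0 : 0 < t) (ht : Agree x g t)
    (hlt : ∀ s, 0 < s → s < t → ¬ Agree x g s) : cycleLength x g = t := by
  refine le_antisymm (Nat.sInf_le ⟨h0, ht⟩) ?_
  by_contra! h
  have hm := Nat.sInf_mem (s := {t | 0 < t ∧ (state x g t).fork = (state x g t).honest}) ⟨t, h0, ht⟩
  exact hlt _ hm.1 h hm.2

open Classical in
/-- The contribution of block `b` to the total distance. -/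
noncomputable def contribution (n₁ : ℕ) (x g : ℕ → Bool) (b : ℕ) : ℕ :=
  if Referred x g n₁ b then distance x g b (nephew x g n₁ b) else 0

theorem totalDistance_eq_sum (n₁ : ℕ) (x g : ℕ → Bool) :
    totalDistance n₁ x g = ∑ b ∈ Finset.range (cycleLength x g), contribution n₁ x g b := rfl

theorem contribution_of_not_uncle {n₁ b : ℕ} (h : ¬ Uncle x g b) : contribution n₁ x g b = 0 :=
  if_neg fun h' => h h'.1

theorem contribution_of_mem {n₁ b t : ℕ} (ht : Agree x g t) (hb : b ∈ (state x g t).fork) :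
    contribution n₁ x g b = 0 :=
  contribution_of_not_uncle fun h => h.1 ((official_iff ht ((lt_of_mem t).1 b hb)).2 hb)

theorem sum_contribution_honest (n₁ : ℕ) (h0 : x 0 = false) :
    phase x (cycleLength x g) = .done ∧ totalDistance n₁ x g =
      ∑ b ∈ Finset.range (cycleLength x g), (phase x b).reward n₁ (x b) (g b) := by
  have ha : Agree x g 1 := by rw [Agree, state_one_of_honest h0]
  have hT : cycleLength x g = 1 := cycleLength_eq one_pos ha (by omega)
  rw [totalDistance_eq_sum, hT]
  refine ⟨by simp [phase, h0, Phase.next], ?_⟩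
  simp only [Finset.sum_range_one]
  rw [contribution_of_mem ha (by simp [state_one_of_honest h0])]
  rfl

/-- Of the siblings 0 and 1, the bits of round 2 decide which one is orphaned; block 2, on top of
the other, is the nephew at distance 1. The reward is credited to round 2, so the two sums agree in
total but not term by term. -/
theorem sum_contribution_tie (hrec : ∀ t, ∃ t' ≥ t, Agree x g t') {n₁ : ℕ} (hn₁ : 1 ≤ n₁)
    (h0 : x 0 = true) (h1 : x 1 = false) :
    phase x (cycleLength x g) = .done ∧ totalDistance n₁ x g =
      ∑ b ∈ Finset.range (cycleLength x g), (phase x b).reward n₁ (x b) (g b) := by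
  have hs := state_three (g := g) h0 h1
  have ha : Agree x g 3 := by
    rw [Agree, hs]
    split_ifs <;> rfl
  have hT : cycleLength x g = 3 := by
    refine cycleLength_eq (by norm_num) ha fun s hs hs' => ?_
    obtain rfl | rfl : s = 1 ∨ s = 2 := by omega
    · simp [Agree, state_one h0]
    · simp [Agree, state_two_of_honest h0 h1]
  have hb0 : base x g 0 = [] := by simp [base, state, State.base, h0]
  have hb1 : base x g 1 = [] := by
    simp [base, state_one h0, State.base, h1, State.published]
  rw [totalDistance_eq_sum, hT]
  refine ⟨by simp [phase, h0, h1, Phase.next], ?_⟩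
  simp only [Finset.sum_range_succ, Finset.sum_range_zero, phase, h0, h1, Phase.next,
    Phase.reward, zero_add]
  by_cases hc : x 2 = true ∨ g 2 = true
  · rw [if_pos hc] at hs
    have e1 : contribution n₁ x g 1 = 1 := by
      have hu : Uncle x g 1 := by
        refine ⟨fun h => ?_, by simp [hb1]⟩
        have := (official_iff ha (by norm_num)).1 h
        simp [hs] at this
      have := uncle_contribution hrec (n₁ := n₁) (F := [0]) hu ha (by norm_num)
        (by rw [hs]; exact ⟨[2], rfl⟩) (by simp [hb1]) (by simp [hb1]) (by simp)
        (by simp [hs])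
      rw [contribution, this]
      simp [hb1, hn₁]
    rw [e1, contribution_of_mem ha (b := 0) (by simp [hs]),
      contribution_of_mem ha (b := 2) (by simp [hs])]
  · rw [if_neg hc] at hs
    have e0 : contribution n₁ x g 0 = 1 := by
      have hu : Uncle x g 0 := by
        refine ⟨fun h => ?_, by simp [hb0]⟩
        have := (official_iff ha (by norm_num)).1 h
        simp [hs] at this
      -- Block 1 is younger than block 0, but as a sibling it is at distance 0 and cannot refer to
      -- it.
      have := uncle_contribution hrec (n₁ := n₁) (F := [1]) hu ha (by norm_num)
        (by rw [hs]; exact ⟨[2], rfl⟩) (by simp [hb0]) (by simp [hb0])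
        (by simp [distance, hb1]) (by simp [hs])
      rw [contribution, this]
      simp [hb0, hn₁]
    rw [e0, contribution_of_mem ha (b := 1) (by simp [hs]),
      contribution_of_mem ha (b := 2) (by simp [hs])]

theorem exists_aheadAt (h0 : x 0 = true) (h1 : x 1 = true) {t : ℕ} (h2 : 2 ≤ t)
    (ht : t < cycleLength x g) : ∃ k fresh, AheadAt x g t k fresh := by
  induction t, h2 using Nat.le_induction with
  | base =>
    have hs := state_two (g := g) h0 h1
    exact ⟨0, true, by simp [phase, h0, h1, Phase.next], by simp [hs], by simp [hs, h0, h1],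
      by simp [hs], by simp [hs]⟩
  | succ t h2 ih =>
    obtain ⟨k, fresh, h⟩ := ih (by omega)
    exact h.succ (not_agree_of_lt (by omega) ht)

/-- A lead of two or more is never lost: the attacker publishes and wins when it shrinks to one. So
his fork is never given up. -/
theorem fork_growth (h0 : x 0 = true) (h1 : x 1 = true) {s t : ℕ} (h2 : 2 ≤ s) (hst : s ≤ t)
    (ht : t ≤ cycleLength x g) : (state x g s).fork <:+ (state x g t).fork ∧
      ∀ a ∈ (state x g t).fork, a ∈ (state x g s).fork ∨ s ≤ a := by
  induction t, hst using Nat.le_induction with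
  | base => exact ⟨List.suffix_refl _, fun a ha => Or.inl ha⟩
  | succ t hst ih =>
    obtain ⟨ih1, ih2⟩ := ih (by omega)
    obtain ⟨k, fresh, h⟩ := exists_aheadAt (g := g) h0 h1 (h2.trans hst) (by omega)
    rw [h.fork_succ]
    split_ifs
    · refine ⟨ih1.trans (List.suffix_cons _ _), fun a ha => ?_⟩
      rcases List.mem_cons.1 ha with rfl | ha
      · exact Or.inr hst
      · exact ih2 a ha
    · exact ⟨ih1, ih2⟩

/-- The winning fork has only blocks of the attacker, so every honest block is an orphan. It is an
uncle when it is the first honest block or is mined on the published fork. Here the sums agree term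
by term. -/
theorem sum_contribution_ahead (hrec : ∀ t, ∃ t' ≥ t, Agree x g t') (n₁ : ℕ)
    (h0 : x 0 = true) (h1 : x 1 = true) :
    phase x (cycleLength x g) = .done ∧ totalDistance n₁ x g =
      ∑ b ∈ Finset.range (cycleLength x g), (phase x b).reward n₁ (x b) (g b) := by
  obtain ⟨hpos, hT⟩ := cycleLength_spec hrec
  have hs1 := state_one (g := g) h0
  have hs2 := state_two (g := g) h0 h1
  have h3 : 3 ≤ cycleLength x g := by
    by_contra! h
    obtain h | h : cycleLength x g = 1 ∨ cycleLength x g = 2 := by omega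
    · rw [h] at hT
      simp [Agree, hs1] at hT
    · rw [h] at hT
      simp [Agree, hs2] at hT
  rw [totalDistance_eq_sum]
  obtain ⟨t, ht⟩ : ∃ t, cycleLength x g = t + 1 := ⟨cycleLength x g - 1, by omega⟩
  obtain ⟨k, fresh, h⟩ := exists_aheadAt (g := g) h0 h1 (t := t) (by omega) (by omega)
  obtain ⟨hxt, hk⟩ := h.of_agree_succ (ht ▸ hT)
  have hfork : (state x g (cycleLength x g)).fork = (state x g t).fork := by
    rw [ht, h.fork_succ, hxt]
    rfl
  have hself : ∀ a ∈ (state x g (cycleLength x g)).fork, x a = true := by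
    rw [hfork]
    exact h.fork_selfish
  refine ⟨?_, Finset.sum_congr rfl fun b hb => ?_⟩
  · rw [ht, phase, h.phase_eq, hxt, hk, Phase.next]
  have hbT : b < cycleLength x g := Finset.mem_range.1 hb
  have hoff : ∀ a, a < cycleLength x g → x a = false → ¬ Official x g a := fun a ha hxa hO => by
    have := hself a ((official_iff hT ha).1 hO)
    simp [hxa] at this
  rcases Nat.lt_or_ge b 2 with hb2 | hb2
  · have hmem : b ∈ (state x g (cycleLength x g)).fork := by
      refine (fork_growth h0 h1 le_rfl (by omega) le_rfl).1.subset ?_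
      rw [hs2]
      simp
      omega
    rw [contribution_of_mem hT hmem]
    obtain rfl | rfl : b = 0 ∨ b = 1 := by omega
    · rfl
    · simp [phase, h0, Phase.next, Phase.reward]
  · obtain ⟨j, fr, hj⟩ := exists_aheadAt (g := g) h0 h1 hb2 hbT
    rw [hj.phase_eq]
    cases hxb : x b with
    | true =>
      have hmem : b ∈ (state x g (cycleLength x g)).fork := by
        refine (fork_growth h0 h1 (s := b + 1) (by omega) (by omega) le_rfl).1.subset ?_
        rw [hj.fork_succ, if_pos hxb]
        exact List.mem_cons_self
      rw [contribution_of_mem hT hmem]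
      rfl
    | false =>
      obtain ⟨hsuf, hnew⟩ := fork_growth (g := g) h0 h1 hb2 hbT.le le_rfl
      rw [Phase.reward]
      have hbase : fr = false → g b = false → base x g b = (state x g b).honest := by
        intro _ hg
        simp [base, State.base, hxb, hg]
      by_cases hc : (fr || g b) = true
      · have hbF : base x g b <:+ (state x g b).fork := by
          rcases Bool.or_eq_true_iff.1 hc with hfr | hg
          -- Nothing is published yet, so either preference of the miner leads to the genesis block
          -- as parent.
          · have : base x g b = [] := by
              rw [← List.length_eq_zero_iff, length_base_of_honest hxb, hj.fresh_iff.1 hfr]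
              rfl
            rw [this]
            exact List.nil_suffix
          · rw [base, State.base, hxb, hg]
            exact State.published_suffix _
        have hu : Uncle x g b := by
          refine ⟨hoff b hbT hxb, fun a ha => ?_⟩
          have hmem := hsuf.subset (hbF.subset (List.mem_of_mem_head? ha))
          exact (official_iff hT ((lt_of_mem _).1 a hmem)).2 hmem
        have hlen := hj.length_eq
        have hlen' := length_base_of_honest (g := g) hxb
        rw [if_pos hc, contribution, uncle_contribution hrec hu hT hbT hsuf hbF (by omega)
          (fun N hN hbN => absurd ((lt_of_mem b).1 N hN) (by omega))
          (fun N hN hN' => ?_), cutoff]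
        · have : (state x g b).fork.length - (base x g b).length = j + 2 := by omega
          rw [this]
        · refine lt_of_le_of_ne ((hnew N hN).resolve_left hN') ?_
          rintro rfl
          have := hself _ hN
          simp [hxb] at this
      · rw [if_neg hc]
        simp only [Bool.or_eq_true, not_or, Bool.not_eq_true] at hc
        -- The parent is the tip of the honest branch, itself an orphan.
        refine contribution_of_not_uncle fun hu => ?_
        obtain ⟨hfr, hg⟩ := hc
        have hne : (state x g b).honest ≠ [] := fun h => by
          simp [hj.fresh_iff.2 h] at hfr
        obtain ⟨a, l, hal⟩ := List.exists_cons_of_ne_nil hne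
        have hxa : x a = false := hj.head_honest a (by rw [hal]; rfl)
        have hab : a < b := (lt_of_mem b).2 a (by rw [hal]; exact List.mem_cons_self)
        exact hoff a (by omega) hxa (hu.2 a (by rw [hbase hfr hg, hal]; rfl))

theorem totalDistance_eq_sum_reward (hrec : ∀ t, ∃ t' ≥ t, Agree x g t') {n₁ : ℕ}
    (hn₁ : 1 ≤ n₁) : phase x (cycleLength x g) = .done ∧ totalDistance n₁ x g =
      ∑ b ∈ Finset.range (cycleLength x g), (phase x b).reward n₁ (x b) (g b) := by
  cases h0 : x 0 with
  | false => exact sum_contribution_honest n₁ h0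
  | true =>
    cases h1 : x 1 with
    | false => exact sum_contribution_tie hrec hn₁ h0 h1
    | true => exact sum_contribution_ahead hrec n₁ h0 h1

/-! ### The cycle ends -/

/-- The lead of the attacker performs a random walk until the cycle ends, so that it ends if this
walk tends to minus infinity. -/
theorem exists_agree_of_tendsto
    (h : Filter.Tendsto (fun n => ∑ i ∈ Finset.range n, if x i = true then (1 : ℝ) else -1)
      Filter.atTop Filter.atBot) (t : ℕ) : ∃ t' ≥ t, Agree x g t' := by
  by_contra! hne
  set S : ℕ → ℝ := fun n => ∑ i ∈ Finset.range n, if x i = true then (1 : ℝ) else -1 with hS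
  -- Without agreement, every round changes the lead by the step of the walk; a lead is nonnegative,
  -- which contradicts the limit.
  have key : ∀ s, t ≤ s →
      ((state x g s).fork.length : ℝ) - (state x g s).honest.length - S s =
        ((state x g t).fork.length : ℝ) - (state x g t).honest.length - S t := by
    intro s hs
    induction s, hs using Nat.le_induction with
    | base => rfl
    | succ s hs ih =>
      rw [← ih]
      have hSs : S (s + 1) = S s + if x s = true then (1 : ℝ) else -1 := Finset.sum_range_succ _ _
      have hb := State.length_base (length_honest_le s (x := x) (g := g)) (x s) (g s)
      have hn := hne (s + 1) (by omega)
      rw [hSs]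
      rw [Agree, state_succ, State.step] at hn
      rw [state_succ, State.step]
      cases hx : x s with
      | true =>
        rw [hx] at hb hn
        simp only [if_true] at hb hn ⊢
        split_ifs at hn ⊢ with h1
        · exact absurd rfl hn
        · simp only [List.length_cons, hb]
          push_cast
          ring
      | false =>
        rw [hx] at hb hn
        simp only [if_false, Bool.false_eq_true] at hb hn ⊢
        split_ifs at hn ⊢ with h1 h2
        · exact absurd rfl hn
        · exact absurd rfl hn
        · simp only [List.length_cons, hb]
          push_cast
          ring
  obtain ⟨s, hs, hs'⟩ := ((Filter.eventually_ge_atTop t).and (h.eventually_lt_atBot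
    (-(((state x g t).fork.length : ℝ) - (state x g t).honest.length - S t)))).exists
  have h1 := key s hs
  have h2 : ((state x g s).honest.length : ℝ) ≤ (state x g s).fork.length := by
    exact_mod_cast length_honest_le s
  have h3 : S s < -(((state x g t).fork.length : ℝ) - (state x g t).honest.length - S t) := hs'
  linarith

/-! ### The potential -/

/-- A truncated arithmetic-geometric series. -/
noncomputable def tailSum (n₁ : ℕ) (s : ℝ) (m : ℕ) : ℝ :=
  ∑ j ∈ Finset.Ico m n₁, (j + 1 : ℝ) * s ^ (j - m)

theorem tailSum_eq (n₁ : ℕ) (s : ℝ) (m : ℕ) :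
    tailSum n₁ s m = cutoff n₁ (m + 1) + s * tailSum n₁ s (m + 1) := by
  rcases Nat.lt_or_ge m n₁ with h | h
  · rw [tailSum, Finset.sum_eq_sum_Ico_succ_bot h, cutoff, if_pos (by omega), tailSum,
      Finset.mul_sum]
    congr 1
    · simp
    · refine Finset.sum_congr rfl fun j hj => ?_
      have := (Finset.mem_Ico.1 hj).1
      rw [show j - m = j - (m + 1) + 1 by omega, pow_succ]
      ring
  · rw [tailSum, tailSum, Finset.Ico_eq_empty (by omega), Finset.Ico_eq_empty (by omega), cutoff,
      if_neg (by omega)]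
    simp

theorem tailSum_of_le {n₁ m : ℕ} (s : ℝ) (h : n₁ ≤ m) : tailSum n₁ s m = 0 := by
  rw [tailSum, Finset.Ico_eq_empty (by omega), Finset.sum_empty]

theorem tailSum_nonneg (n₁ : ℕ) {s : ℝ} (hs : 0 ≤ s) (m : ℕ) : 0 ≤ tailSum n₁ s m :=
  Finset.sum_nonneg fun _ _ => by positivity

theorem tailSum_le (n₁ : ℕ) {s : ℝ} (hs : 0 ≤ s) (hs1 : s ≤ 1) (m : ℕ) :
    tailSum n₁ s m ≤ ∑ j ∈ Finset.range n₁, (j + 1 : ℝ) := by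
  calc tailSum n₁ s m ≤ ∑ j ∈ Finset.Ico m n₁, (j + 1 : ℝ) :=
        Finset.sum_le_sum fun j _ =>
          mul_le_of_le_one_right (by positivity) (pow_le_one₀ hs hs1)
    _ ≤ _ := Finset.sum_le_sum_of_subset_of_nonneg
        (fun j hj => Finset.mem_range.2 (Finset.mem_Ico.1 hj).2) fun _ _ _ => by positivity

theorem tailSum_one {n₁ : ℕ} (hn₁ : 1 ≤ n₁) (s : ℝ) :
    (1 - s) ^ 2 * tailSum n₁ s 1 = 2 - s - (n₁ + 1 - n₁ * s) * s ^ (n₁ - 1) := by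
  induction n₁, hn₁ using Nat.le_induction with
  | base => simp [tailSum]; ring
  | succ n hn ih =>
    rw [tailSum, Finset.sum_Ico_succ_top hn, ← tailSum, mul_add, ih]
    obtain ⟨m, rfl⟩ : ∃ m, n = m + 1 := ⟨n - 1, by omega⟩
    simp only [Nat.add_sub_cancel]
    push_cast
    ring

/-- The expected total distance that is still to come when the attacker leads by `k + 2` blocks
and the honest branch is not empty. -/
noncomputable def lateValue (p q γ : ℝ) (n₁ k : ℕ) : ℝ :=
  γ * ∑ m ∈ Finset.range (k + 1), tailSum n₁ (q / p) (m + 1)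

/-- The expected value of the total distance that is still to come in a phase. -/
noncomputable def potential (p q γ : ℝ) (n₁ : ℕ) : Phase → ℝ
  | .init => q * (q * (lateValue p q γ n₁ 0 + (1 - γ) * (p * tailSum n₁ q 1)) + p)
  | .one => q * (lateValue p q γ n₁ 0 + (1 - γ) * (p * tailSum n₁ q 1)) + p
  | .tie => 1
  | .ahead k true => lateValue p q γ n₁ k + (1 - γ) * (p * tailSum n₁ q (k + 1))
  | .ahead k false => lateValue p q γ n₁ k
  | .done => 0

/-- The mean of a function of two independent bits with success probabilities `q` and `γ`. -/
def bitMean (q γ : ℝ) (f : Bool → Bool → ℝ) : ℝ :=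
  q * (γ * f true true + (1 - γ) * f true false) +
    (1 - q) * (γ * f false true + (1 - γ) * f false false)

/-- With `L k` for `lateValue`, the balance is `L k = q L (k+1) + p (γ c + L (k-1))`, where `c =
cutoff n₁ (k+2)` and `L (-1) = 0`. The increments of `L` thus satisfy a first order recursion with
ratio `q/p`, solved by `γ` times `tailSum`; truncation selects its bounded solution. The first
honest block counts with probability 1 instead of `γ`, and waiting for it adds the term with ratio
`q`. -/
theorem bitMean_potential {p q γ : ℝ} (hpq : p + q = 1) (hp : p ≠ 0) (n₁ : ℕ) (s : Phase) :
    bitMean q γ (fun u v => (s.reward n₁ u v : ℝ) + potential p q γ n₁ (s.next u) -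
      potential p q γ n₁ s) = 0 := by
  obtain rfl : p = 1 - q := by linarith
  have hr : (1 - q) * (q / (1 - q)) = q := mul_div_cancel₀ q hp
  rcases s with _ | _ | _ | ⟨_ | k, _ | _⟩ | _
  · simp [bitMean, Phase.reward, Phase.next, potential]
    ring
  · simp [bitMean, Phase.reward, Phase.next, potential]
    ring
  · simp [bitMean, Phase.reward, Phase.next, potential]
  · have h1 := tailSum_eq n₁ (q / (1 - q)) 1
    simp [bitMean, Phase.reward, Phase.next, potential, lateValue, Finset.sum_range_succ]
    linear_combination (-(1 - q) * γ) * h1 - γ * tailSum n₁ (q / (1 - q)) 2 * hr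
  · have h1 := tailSum_eq n₁ (q / (1 - q)) 1
    have h2 := tailSum_eq n₁ q 1
    simp [bitMean, Phase.reward, Phase.next, potential, lateValue, Finset.sum_range_succ]
    linear_combination (-(1 - q) * γ) * h1 - γ * tailSum n₁ (q / (1 - q)) 2 * hr
      - (1 - γ) * (1 - q) * h2
  · have h1 := tailSum_eq n₁ (q / (1 - q)) (k + 2)
    simp [bitMean, Phase.reward, Phase.next, potential, lateValue,
      Finset.sum_range_succ _ (k + 1 + 1), Finset.sum_range_succ _ (k + 1)]
    linear_combination (-(1 - q) * γ) * h1 - γ * tailSum n₁ (q / (1 - q)) (k + 3) * hr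
  · have h1 := tailSum_eq n₁ (q / (1 - q)) (k + 2)
    have h2 := tailSum_eq n₁ q (k + 2)
    simp [bitMean, Phase.reward, Phase.next, potential, lateValue,
      Finset.sum_range_succ _ (k + 1 + 1), Finset.sum_range_succ _ (k + 1)]
    linear_combination (-(1 - q) * γ) * h1 - γ * tailSum n₁ (q / (1 - q)) (k + 3) * hr
      - (1 - γ) * (1 - q) * h2
  · simp [bitMean, Phase.reward, Phase.next, potential]

theorem potential_bounded {p q γ : ℝ} (hp : 0 < p) (hq : 0 ≤ q)
    (hγ₀ : 0 ≤ γ) (hγ₁ : γ ≤ 1) (hq1 : q ≤ 1) (n₁ : ℕ) :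
    ∃ C, ∀ s, |potential p q γ n₁ s| ≤ C := by
  have hr : 0 ≤ q / p := by positivity
  set A : ℝ := γ * ∑ m ∈ Finset.range n₁, tailSum n₁ (q / p) (m + 1)
  set B : ℝ := (1 - γ) * (p * ∑ j ∈ Finset.range n₁, (j + 1 : ℝ))
  have h1γ : 0 ≤ 1 - γ := by linarith
  have hB : 0 ≤ B := by positivity
  have hL0 : ∀ k, 0 ≤ lateValue p q γ n₁ k := fun k =>
    mul_nonneg hγ₀ (Finset.sum_nonneg fun m _ => tailSum_nonneg _ hr _)
  have hL : ∀ k, lateValue p q γ n₁ k ≤ A := fun k => by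
    -- The terms vanish for `m ≥ n₁`, so every partial sum is bounded by the same finite sum.
    have hsum : HasSum (fun m => tailSum n₁ (q / p) (m + 1))
        (∑ m ∈ Finset.range n₁, tailSum n₁ (q / p) (m + 1)) :=
      hasSum_sum_of_ne_finset_zero fun m hm =>
        tailSum_of_le _ ((not_lt.1 fun h => hm (Finset.mem_range.2 h)).trans (Nat.le_succ m))
    exact mul_le_mul_of_nonneg_left
      (sum_le_hasSum _ (fun m _ => tailSum_nonneg _ hr _) hsum) hγ₀
  have hU0 : ∀ k, 0 ≤ (1 - γ) * (p * tailSum n₁ q k) := fun k =>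
    mul_nonneg h1γ (mul_nonneg hp.le (tailSum_nonneg _ hq _))
  have hU : ∀ k, (1 - γ) * (p * tailSum n₁ q k) ≤ B := fun k =>
    mul_le_mul_of_nonneg_left (mul_le_mul_of_nonneg_left (tailSum_le _ hq hq1 _) hp.le) h1γ
  have hA : 0 ≤ A := (hL0 0).trans (hL 0)
  have hone : q * (lateValue p q γ n₁ 0 + (1 - γ) * (p * tailSum n₁ q 1)) ≤ A + B :=
    (mul_le_of_le_one_left (add_nonneg (hL0 0) (hU0 1)) hq1).trans (add_le_add (hL 0) (hU 1))
  have hone0 : 0 ≤ q * (lateValue p q γ n₁ 0 + (1 - γ) * (p * tailSum n₁ q 1)) :=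
    mul_nonneg hq (add_nonneg (hL0 0) (hU0 1))
  have hinit : q * (q * (lateValue p q γ n₁ 0 + (1 - γ) * (p * tailSum n₁ q 1)) + p) ≤
      A + B + p := (mul_le_of_le_one_left (by linarith) hq1).trans (by linarith)
  have hinit0 := mul_nonneg hq (add_nonneg hone0 hp.le)
  refine ⟨A + B + p + 1, fun s => abs_le.2 ?_⟩
  rcases s with _ | _ | _ | ⟨k, _ | _⟩ | _ <;> simp only [potential]
  · constructor <;> linarith
  · constructor <;> linarith
  · constructor <;> linarith
  · constructor <;> linarith [hL0 k, hL k]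
  · constructor <;> linarith [hL0 k, hL k, hU0 (k + 1), hU (k + 1)]
  · constructor <;> linarith

theorem potential_init {p q γ : ℝ} (hpq : p + q = 1) (hq : 0 ≤ q) (hqp : q < p) {n₁ : ℕ}
    (hn₁ : 1 ≤ n₁) :
    potential p q γ n₁ .init = p * q
          + p * q ^ 2 * γ / (p - q) ^ 2 *
              (2 * p - q - (p + n₁ * (p - q)) * (q / p) ^ (n₁ - 1))
          + (1 - γ) * q / p * (q * (1 + p) - (1 + n₁ * p) * q ^ n₁) := by
  have hp : p ≠ 0 := by linarith
  have hd : p - q ≠ 0 := by linarith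
  have h1 := tailSum_one hn₁ (q / p)
  have h2 := tailSum_one hn₁ q
  have e1 : p * tailSum n₁ (q / p) 1 * (p - q) ^ 2 = p ^ 2 *
      (2 * p - q - (p + n₁ * (p - q)) * (q / p) ^ (n₁ - 1)) := by
    have hr : p * (q / p) = q := mul_div_cancel₀ q hp
    -- Writing `q = p * r` turns the claim into a polynomial identity.
    generalize q / p = r at *
    subst hr
    linear_combination p ^ 3 * h1
  have e2 : p * (p * tailSum n₁ q 1) * q = q * (1 + p) - (1 + n₁ * p) * q ^ n₁ := by
    have hq' : q ^ n₁ = q ^ (n₁ - 1) * q := by rw [← pow_succ, Nat.sub_add_cancel hn₁]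
    rw [hq']
    obtain rfl : p = 1 - q := by linarith
    linear_combination q * h2
  have e3 : tailSum n₁ (q / p) 1 = p / (p - q) ^ 2 *
      (2 * p - q - (p + n₁ * (p - q)) * (q / p) ^ (n₁ - 1)) := by
    have hd2 : (p - q) ^ 2 ≠ 0 := pow_ne_zero 2 hd
    rw [div_mul_eq_mul_div, eq_div_iff hd2]
    apply mul_left_cancel₀ hp
    linear_combination e1
  simp only [potential, lateValue, zero_add, Finset.sum_range_one]
  rw [← e2, e3]
  field_simp
  ring

/-! ### Independence of the bits and the law of large numbers -/

section Bits

variable {Ω : Type*} [MeasurableSpace Ω] {μ : Measure Ω} [IsProbabilityMeasure μ]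

theorem integral_comp_bool {Y : Ω → Bool} (hY : Measurable Y) {a : ℝ} (ha : 0 ≤ a)
    (hYa : μ {ω | Y ω = true} = ENNReal.ofReal a) (f : Bool → ℝ) :
    ∫ ω, f (Y ω) ∂μ = a * f true + (1 - a) * f false := by
  have hm : MeasurableSet {ω | Y ω = true} := hY (measurableSet_singleton true)
  have hf : (fun ω => f (Y ω)) =
      fun ω => f false + {ω | Y ω = true}.indicator (fun _ => f true - f false) ω := by
    funext ω
    cases h : Y ω <;> simp [Set.indicator, h]
  rw [hf, integral_add (integrable_const _) ((integrable_const _).indicator hm),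
    integral_indicator_const _ hm, integral_const, measureReal_def, measureReal_def, hYa,
    ENNReal.toReal_ofReal ha]
  simp
  ring

end Bits

/-- `φ` depends only on the first `n` bits. -/
def DependsOnFirst {β : Type*} (n : ℕ) (φ : (ℕ → Bool) → β) : Prop :=
  ∀ x y : ℕ → Bool, (∀ i < n, x i = y i) → φ x = φ y

/-- Extends a finite family of bits by zeros. -/
def extendBits {n : ℕ}
    (z : ((Finset.range n).map ⟨Sum.inl, Sum.inl_injective⟩ : Finset (ℕ ⊕ ℕ)) → Bool) (i : ℕ) :
    Bool :=
  if h : i < n then z ⟨Sum.inl i, by simpa using h⟩ else false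

theorem DependsOnFirst.eq_extendBits {β : Type*} {n : ℕ} {φ : (ℕ → Bool) → β}
    (hφ : DependsOnFirst n φ) {Ω : Type*} {X G : ℕ → Ω → Bool} (ω : Ω) : φ (fun i => X i ω) =
      φ (extendBits (n := n) fun i => Sum.elim X G i ω) := by
  refine hφ _ _ fun i hi => ?_
  simp [extendBits, hi]

section Independence

variable {Ω : Type*} [MeasurableSpace Ω] {μ : Measure Ω} {X G : ℕ → Ω → Bool}

/-- The past enters through finitely many bits, so both sides are functions on finite types of
disjoint subfamilies, and their measurability is automatic. -/
theorem indepFun_first (hX : ∀ n, Measurable (X n)) (hG : ∀ n, Measurable (G n))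
    (hindep : iIndepFun (fun i : ℕ ⊕ ℕ => Sum.elim X G i) μ) {n : ℕ} {φ : (ℕ → Bool) → ℝ}
    (hφ : DependsOnFirst n φ) (f : Bool → Bool → ℝ) :
    IndepFun (fun ω => φ fun i => X i ω) (fun ω => f (X n ω) (G n ω)) μ := by
  have hmeas : ∀ i : ℕ ⊕ ℕ, Measurable (Sum.elim X G i) := by
    rintro (i | i)
    · exact hX i
    · exact hG i
  have h := hindep.indepFun_finset ((Finset.range n).map ⟨Sum.inl, Sum.inl_injective⟩)
    {Sum.inl n, Sum.inr n} (by
      simp only [Finset.disjoint_left, Finset.mem_map, Finset.mem_range]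
      rintro _ ⟨i, hi, rfl⟩
      simpa using hi.ne) hmeas
  have h' := h.comp (φ := fun z => φ (extendBits z))
    (ψ := fun z => f (z ⟨Sum.inl n, by simp⟩) (z ⟨Sum.inr n, by simp⟩))
    (measurable_of_finite _) (measurable_of_finite _)
  exact h'.congr (Filter.Eventually.of_forall fun ω => (hφ.eq_extendBits (G := G) ω).symm)
    (Filter.Eventually.of_forall fun ω => rfl)

variable [IsProbabilityMeasure μ]

theorem integrable_first (hX : ∀ n, Measurable (X n)) {n : ℕ} {φ : (ℕ → Bool) → ℝ}
    (hφ : DependsOnFirst n φ) : Integrable (fun ω => φ fun i => X i ω) μ := by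
  have h : (fun ω => φ fun i => X i ω) =
      (fun z : Fin n → Bool => φ fun i => if h : i < n then z ⟨i, h⟩ else false) ∘
        fun ω i => X i ω := by
    funext ω
    exact hφ _ _ fun i hi => by simp [hi]
  rw [h]
  exact Integrable.of_finite.comp_measurable (measurable_pi_lambda _ fun i => hX i)

theorem integrable_comp_pair {Y Z : Ω → Bool} (hY : Measurable Y) (hZ : Measurable Z)
    (f : Bool → Bool → ℝ) : Integrable (fun ω => f (Y ω) (Z ω)) μ :=
  (Integrable.of_finite (f := fun a : Bool × Bool => f a.1 a.2)).comp_measurable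
    (hY.prodMk hZ)

theorem eq_sum_bits (f : Bool → Bool → ℝ) (u v : Bool) :
    f u v = ∑ u' : Bool, ∑ v' : Bool, f u' v' * ((if u = u' then 1 else 0) *
      if v = v' then 1 else 0) := by
  cases u <;> cases v <;> simp

theorem integral_comp_pair {q γ : ℝ} (hq : 0 ≤ q) (hγ : 0 ≤ γ) {n : ℕ}
    (hX : ∀ n, Measurable (X n)) (hG : ∀ n, Measurable (G n))
    (hXq : ∀ n, μ {ω | X n ω = true} = ENNReal.ofReal q)
    (hGγ : ∀ n, μ {ω | G n ω = true} = ENNReal.ofReal γ)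
    (hindep : iIndepFun (fun i : ℕ ⊕ ℕ => Sum.elim X G i) μ) (a b : Bool → ℝ) :
    ∫ ω, a (X n ω) * b (G n ω) ∂μ = bitMean q γ fun u v => a u * b v := by
  have h : IndepFun (X n) (G n) μ :=
    hindep.indepFun (i := Sum.inl n) (j := Sum.inr n) (by simp)
  rw [h.integral_fun_comp_mul_comp (hX n).aemeasurable (hG n).aemeasurable
    (measurable_of_finite a).aestronglyMeasurable (measurable_of_finite b).aestronglyMeasurable,
    integral_comp_bool (hX n) hq (hXq n), integral_comp_bool (hG n) hγ (hGγ n), bitMean]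
  ring

/-- The bits of round `n` may be averaged out, since they are independent of the past. -/
theorem integral_round {q γ : ℝ} (hq : 0 ≤ q) (hγ : 0 ≤ γ) {n : ℕ}
    (hX : ∀ n, Measurable (X n)) (hG : ∀ n, Measurable (G n))
    (hXq : ∀ n, μ {ω | X n ω = true} = ENNReal.ofReal q)
    (hGγ : ∀ n, μ {ω | G n ω = true} = ENNReal.ofReal γ)
    (hindep : iIndepFun (fun i : ℕ ⊕ ℕ => Sum.elim X G i) μ)
    {φ : (ℕ → Bool) → Bool → Bool → ℝ} (hφ : DependsOnFirst n φ) :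
    Integrable (fun ω => φ (fun i => X i ω) (X n ω) (G n ω)) μ ∧
      ∫ ω, φ (fun i => X i ω) (X n ω) (G n ω) ∂μ =
        ∫ ω, bitMean q γ (φ fun i => X i ω) ∂μ := by
  have hφ' : ∀ u v, DependsOnFirst n fun x => φ x u v := fun u v x y hxy => by
    simp only [hφ x y hxy]
  set e : Bool → Bool → ℝ := fun u w => if w = u then 1 else 0
  have hi1 : ∀ u v, Integrable (fun ω => φ (fun i => X i ω) u v) μ := fun u v =>
    integrable_first hX (hφ' u v)
  have hi2 : ∀ u v, Integrable (fun ω => e u (X n ω) * e v (G n ω)) μ := fun u v =>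
    integrable_comp_pair (hX n) (hG n) fun a b => e u a * e v b
  have hind := fun u v => indepFun_first hX hG hindep (hφ' u v) fun a b => e u a * e v b
  have hint : ∀ u v, Integrable (fun ω => φ (fun i => X i ω) u v *
      (e u (X n ω) * e v (G n ω))) μ := fun u v =>
    (hind u v).integrable_mul (hi1 u v) (hi2 u v)
  -- Splitting by the four values of the current bits gives products of a past factor and an
  -- independent present one.
  have hexp : (fun ω => φ (fun i => X i ω) (X n ω) (G n ω)) = fun ω =>
      ∑ u : Bool, ∑ v : Bool, φ (fun i => X i ω) u v * (e u (X n ω) * e v (G n ω)) := by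
    funext ω
    exact eq_sum_bits _ _ _
  have hterm : ∀ u v, ∫ ω, φ (fun i => X i ω) u v * (e u (X n ω) * e v (G n ω)) ∂μ =
      ∫ ω, φ (fun i => X i ω) u v * bitMean q γ (fun a b => e u a * e v b) ∂μ := fun u v => by
    rw [(hind u v).integral_fun_mul_eq_mul_integral (hi1 u v).aestronglyMeasurable
      (hi2 u v).aestronglyMeasurable, integral_comp_pair hq hγ hX hG hXq hGγ hindep,
      integral_mul_const]
  rw [hexp]
  refine ⟨integrable_finsetSum _ fun u _ => integrable_finsetSum _ fun v _ => hint u v, ?_⟩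
  rw [integral_finsetSum _ fun u _ => integrable_finsetSum _ fun v _ => hint u v]
  simp_rw [integral_finsetSum _ fun v _ => hint _ v, hterm]
  simp_rw [← integral_finsetSum _ fun v _ => (hi1 _ v).mul_const _]
  rw [← integral_finsetSum _ fun u _ => integrable_finsetSum _ fun v _ => (hi1 u v).mul_const _]
  refine integral_congr_ae (Filter.Eventually.of_forall fun ω => ?_)
  simp [bitMean, e]
  ring

/-- The steps have mean `2q - 1 < 0`, so by the strong law the walk decreases linearly. -/
theorem ae_tendsto_walk {q : ℝ} (hq : 0 ≤ q) (hq2 : q < 1 / 2) (hX : ∀ n, Measurable (X n))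
    (hXq : ∀ n, μ {ω | X n ω = true} = ENNReal.ofReal q)
    (hindep : Pairwise fun i j => IndepFun (X i) (X j) μ) :
    ∀ᵐ ω ∂μ, Filter.Tendsto
      (fun n => ∑ i ∈ Finset.range n, if X i ω = true then (1 : ℝ) else -1)
      Filter.atTop Filter.atBot := by
  set f : Bool → ℝ := fun u => if u = true then 1 else -1
  have hf : Measurable f := measurable_of_finite f
  have hid : ∀ i, IdentDistrib (X i) (X 0) μ μ := fun i => by
    refine ⟨(hX i).aemeasurable, (hX 0).aemeasurable, ?_⟩
    have hpi : ∀ j, IsProbabilityMeasure (μ.map (X j)) := fun j =>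
      Measure.isProbabilityMeasure_map (hX j).aemeasurable
    have htrue : ∀ j, μ.map (X j) {true} = ENNReal.ofReal q := fun j => by
      rw [Measure.map_apply (hX j) (measurableSet_singleton _), ← hXq j]
      rfl
    have hfalse : ∀ j, μ.map (X j) {false} = 1 - ENNReal.ofReal q := fun j => by
      rw [← htrue j, ← prob_compl_eq_one_sub (measurableSet_singleton _)]
      congr 1
      ext u
      cases u <;> simp
    refine Measure.ext_iff_singleton.2 fun u => ?_
    cases u
    · rw [hfalse, hfalse]
    · rw [htrue, htrue]
  have h := strong_law_ae_real (fun i ω => f (X i ω))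
    ((Integrable.of_finite (f := f)).comp_measurable (hX 0))
    (fun i j hij => (hindep hij).comp hf hf) (fun i => (hid i).comp hf)
  rw [integral_comp_bool (hX 0) hq (hXq 0)] at h
  filter_upwards [h] with ω hω
  have hneg : q * f true + (1 - q) * f false < 0 := by
    simp only [f]
    norm_num
    linarith
  have := Filter.Tendsto.neg_mul_atTop hneg hω tendsto_natCast_atTop_atTop
  refine this.congr' ?_
  filter_upwards [Filter.eventually_gt_atTop 0] with n hn
  have : (n : ℝ) ≠ 0 := by positivity
  rw [div_mul_cancel₀ _ this]

end Independence

end SelfishMining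

/-! ### Passage to the limit -/

open SelfishMining in
theorem mainTheorem6 {Ω : Type*} [MeasurableSpace Ω] (μ : Measure Ω) [IsProbabilityMeasure μ]
    (p q γ : ℝ) (hpq : p + q = 1) (hq : 0 ≤ q) (hqp : q < p) (hγ₀ : 0 ≤ γ) (hγ₁ : γ ≤ 1)
    (n₁ : ℕ) (hn₁ : 1 ≤ n₁)
    -- `X n` : the attacker mines the block of round `n`;
    -- `G n` : the miner of that block, if honest, prefers the attacker's branch.
    (X G : ℕ → Ω → Bool) (hX : ∀ n, Measurable (X n)) (hG : ∀ n, Measurable (G n))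
    (hXq : ∀ n, μ {ω | X n ω = true} = ENNReal.ofReal q)
    (hGγ : ∀ n, μ {ω | G n ω = true} = ENNReal.ofReal γ)
    (hindep : iIndepFun (fun i : ℕ ⊕ ℕ => Sum.elim X G i) μ) :
    Integrable (fun ω => (SelfishMining.totalDistance n₁ (fun n => X n ω) (fun n => G n ω) : ℝ)) μ ∧
      ∫ ω, (SelfishMining.totalDistance n₁ (fun n => X n ω) (fun n => G n ω) : ℝ) ∂μ =
        p * q
          + p * q ^ 2 * γ / (p - q) ^ 2 *
              (2 * p - q - (p + n₁ * (p - q)) * (q / p) ^ (n₁ - 1))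
          + (1 - γ) * q / p * (q * (1 + p) - (1 + n₁ * p) * q ^ n₁) := by
  have hp : 0 < p := hq.trans_lt hqp
  rw [← potential_init hpq hq hqp hn₁]
  obtain ⟨C, hC⟩ := potential_bounded hp hq hγ₀ hγ₁ (by linarith) n₁
  set Φ := potential p q γ n₁
  set R : ℕ → Ω → ℝ := fun b ω =>
    ((phase (fun i => X i ω) b).reward n₁ (X b ω) (G b ω) : ℝ) with hR
  set P : ℕ → Ω → ℝ := fun b ω => Φ (phase (fun i => X i ω) b) with hP
  set S : ℕ → Ω → ℝ := fun N ω => ∑ b ∈ Finset.range N, R b ω with hS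
  have hdep : ∀ {β : Type} (n : ℕ) (F : Phase → β), DependsOnFirst n fun x => F (phase x n) :=
    fun n F x y hxy => by simp only [phase_congr hxy]
  have hPint : ∀ n, Integrable (P n) μ := fun n => integrable_first hX (hdep n Φ)
  have hRint : ∀ n, Integrable (R n) μ := fun n =>
    (integral_round hq hγ₀ hX hG hXq hGγ hindep
      (hdep n fun s u v => (s.reward n₁ u v : ℝ))).1
  have hSint : ∀ N, Integrable (S N) μ := fun N => integrable_finsetSum _ fun b _ => hRint b
  have hround : ∀ n, ∫ ω, R n ω ∂μ = ∫ ω, P n ω ∂μ - ∫ ω, P (n + 1) ω ∂μ := fun n => by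
    have h := (integral_round hq hγ₀ hX hG hXq hGγ hindep
      (hdep n fun s u v => (s.reward n₁ u v : ℝ) + Φ (s.next u) - Φ s)).2
    simp only [Φ, bitMean_potential hpq hp.ne', integral_zero] at h
    have h' : ∫ ω, (R n ω + P (n + 1) ω - P n ω) ∂μ = 0 := h
    rw [integral_sub (f := fun ω => R n ω + P (n + 1) ω) ((hRint n).add (hPint _)) (hPint n),
      integral_add (hRint n) (hPint _)] at h'
    linarith
  have hSval : ∀ N, ∫ ω, S N ω ∂μ = Φ .init - ∫ ω, P N ω ∂μ := fun N => by
    rw [integral_finsetSum _ fun b _ => hRint b, Finset.sum_congr rfl fun n _ => hround n,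
      Finset.sum_range_sub' fun n => ∫ ω, P n ω ∂μ]
    simp [hP, phase]
  have hrec : ∀ᵐ ω ∂μ, ∀ t, ∃ t' ≥ t, Agree (fun n => X n ω) (fun n => G n ω) t' := by
    filter_upwards [ae_tendsto_walk hq (by linarith) hX hXq fun i j hij =>
      hindep.indepFun (i := Sum.inl i) (j := Sum.inl j) (by simpa using hij)] with ω hω
    exact exists_agree_of_tendsto hω
  set D : Ω → ℝ := fun ω => (totalDistance n₁ (fun n => X n ω) (fun n => G n ω) : ℝ) with hD
  -- The partial sums are constant once the cycle is over.
  have hSD : ∀ᵐ ω ∂μ, Filter.Tendsto (fun N => S N ω) Filter.atTop (nhds (D ω)) := by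
    filter_upwards [hrec] with ω hω
    obtain ⟨h1, h2⟩ := totalDistance_eq_sum_reward hω hn₁
    refine tendsto_const_nhds.congr' ?_
    filter_upwards [Filter.eventually_ge_atTop
      (cycleLength (fun n => X n ω) fun n => G n ω)] with N hN
    simp only [hD, h2, ← sum_reward_of_done h1 hN, hS, hR]
    push_cast
    rfl
  have hP0 : Filter.Tendsto (fun N => ∫ ω, P N ω ∂μ) Filter.atTop (nhds 0) := by
    rw [← integral_zero Ω ℝ (μ := μ)]
    refine tendsto_integral_of_dominated_convergence (fun _ => C)
      (fun N => (hPint N).aestronglyMeasurable) (integrable_const _)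
      (fun N => Filter.Eventually.of_forall fun ω => hC _) ?_
    filter_upwards [hrec] with ω hω
    refine tendsto_const_nhds.congr' ?_
    filter_upwards [Filter.eventually_ge_atTop
      (cycleLength (fun n => X n ω) fun n => G n ω)] with N hN
    simp only [hP, phase_done (totalDistance_eq_sum_reward hω hn₁).1 hN]
    rfl
  have hlim : Filter.Tendsto (fun N => ∫ ω, S N ω ∂μ) Filter.atTop (nhds (Φ .init)) := by
    simp_rw [hSval]
    simpa using hP0.const_sub (Φ .init)
  have hR0 : ∀ b ω, 0 ≤ R b ω := fun b ω => Nat.cast_nonneg _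
  have hmono : ∀ ω, Monotone fun N => S N ω := fun ω =>
    monotone_nat_of_le_succ fun N => by
      simp only [hS, Finset.sum_range_succ]
      exact le_add_of_nonneg_right (hR0 N ω)
  -- Measurability comes from the limit, which avoids the combinatorial definition of
  -- `totalDistance`.
  have hDm : AEStronglyMeasurable D μ :=
    aestronglyMeasurable_of_tendsto_ae _ (fun N => (hSint N).aestronglyMeasurable) hSD
  have hl1 := lintegral_tendsto_of_tendsto_of_monotone
    (fun N => (hSint N).aestronglyMeasurable.aemeasurable.ennreal_ofReal)
    (Filter.Eventually.of_forall fun ω => fun a b hab => ENNReal.ofReal_le_ofReal (hmono ω hab))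
    (hSD.mono fun ω hω => (ENNReal.continuous_ofReal.tendsto _).comp hω)
  have hl2 : Filter.Tendsto (fun N => ∫⁻ ω, ENNReal.ofReal (S N ω) ∂μ) Filter.atTop
      (nhds (ENNReal.ofReal (Φ .init))) := by
    refine ((ENNReal.continuous_ofReal.tendsto _).comp hlim).congr fun N => ?_
    exact ofReal_integral_eq_lintegral_ofReal (hSint N)
      (Filter.Eventually.of_forall fun ω => Finset.sum_nonneg fun b _ => hR0 b ω)
  have hl := tendsto_nhds_unique hl1 hl2
  -- By monotone convergence the integral of the nonnegative limit is the initial potential, hence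
  -- finite.
  have hDint : Integrable D μ := by
    rw [← lintegral_ofReal_ne_top_iff_integrable hDm
      (Filter.Eventually.of_forall fun ω => Nat.cast_nonneg _), hl]
    exact ENNReal.ofReal_ne_top
  exact ⟨hDint, tendsto_nhds_unique (integral_tendsto_of_tendsto_of_monotone hSint hDint
    (Filter.Eventually.of_forall hmono) hSD) hlim⟩
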